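/- **Global Markov property for causal Bayesian networks with input nodes.** *Graphs.* A conditional directed mixed graph (CDMG) $G=(J,V,E,L)$ has disjoint sets $J$ (input nodes) and $V$ (output nodes), directed edges $w\to v$ with $w\in J\cup V$, $v\in V$, and symmetric bidirected edges $v\leftrightarrow w$ with $v\ne w$ in $V$. A walk is a finite alternating sequence of nodes and edges, with repetitions allowed; trivial walks are included. $\mathrm{Pa}(v)$ is the set of parents of $v$, and $\mathrm{Sc}(v)$ is the set of nodes that are both ancestors and descendants of $v$ (so $v\in\mathrm{Sc}(v)$). A walk $v_0,\dots,v_n$ is $\sigma$-blocked by $C\subseteq J\cup V$ if $v_0\in C$ or $v_n\in C$ or it contains two adjacent edges of one of the following forms, where $*$ stands for an arrow head or a tail: $v_{k-1}\leftarrow v_k\leftarrow\!* \,v_{k+1}$ with $v_k\in C\setminus \mathrm{Sc}(v_{k-1})$; $v_{k-1}*\!\to v_k\to v_{k+1}$ with $v_k\in C\setminus\mathrm{Sc}(v_{k+1})$; $v_{k-1}\leftarrow v_k\to v_{k+1}$ with $v_k\in C\setminus(\mathrm{Sc}(v_{k-1})\cap\mathrm{Sc}(v_{k+1}))$; $v_{k-1}*\!\to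 v_k\leftarrow\!*\,v_{k+1}$ with $v_k\notin C$. For $A,B,C\subseteq J\cup V$ we write $A\perp^\sigma_G B\mid C$ if every walk from a node of $A$ to a node of $J\cup B$ is $\sigma$-blocked by $C$. For $W\subseteq V$, the marginal CDMG of $G$ on $(J, V\setminus W)$ has an edge $a\to b$ (with $b \in V\setminus W$) iff $G$ has a directed walk from $a$ to $b$ of length $\ge1$ with all intermediate nodes in $W$, and an edge $a\leftrightarrow b$ (with $a\neq b$ in $V\setminus W$) iff $G$ has a walk $a\leftarrow\cdots\leftarrow x\,*\!\!\to y\to\cdots\to b$ with arrow heads at $a$ and $b$ and all intermediate nodes in $W$. *Transitional conditional independence.* Let $K(W|T)$ be a Markov kernel from $\mathcal T$ to $\mathcal W$, and let $\mathbf X,\mathbf Y,\mathbf Z$ be Markov kernels from $\mathcal W\times\mathcal T$ to measurable spaces $\mathcal X,\mathcal Y,\mathcal Z$ (measurable maps count as deterministic kernels). Put $K(X,Y,Z|T)=(\mathbf X\otimes\mathbf Y\otimes\mathbf Z)\circ K(W|T)$. Then $\mathbf X\perp\!\!\!\perp_{K}\mathbf Y\mid\mathbf Z$ means that there is a Markov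 kernel $Q(X|Z)$ from $\mathcal Z$ to $\mathcal X$ with $K(X,Y,Z|T)=Q(X|Z)\otimes K(Y,Z|T)$. *Networks.* A causal Bayesian network consists of a finite acyclic CDMG $G$ with nodes $J\,\dot\cup\,V$ and no bidirected edges, a measurable space $\mathcal X_v$ for each $v\in J\cup V$, standard Borel if $v\in V$, and a Markov kernel $P_v(X_v|\mathrm{do}(X_{\mathrm{Pa}(v)}))$ from $\mathcal X_{\mathrm{Pa}(v)}$ to $\mathcal X_v$ for each $v\in V$; here $\mathcal X_D=\prod_{v\in D}\mathcal X_v$. Its joint Markov kernel $P(X_V|\mathrm{do}(X_J))$ from $\mathcal X_J$ to $\mathcal X_V$ is the product $\bigotimes_{v\in V}P_v(X_v|\mathrm{do}(X_{\mathrm{Pa}(v)}))$ taken along a topological order, with children to the left of their parents. For $D\subseteq J\cup V$ let $X_D$ be the projection $\mathcal X_V\times\mathcal X_J\to\mathcal X_D$. **Theorem.** (1) For every causal Bayesian network, every topological order used to form the joint kernel, and all (not necessarily disjoint) $A,B,C\subseteq J\cup V$, $$A\perp^\sigma_{G}B\mid C\quad\Longrightarrow\quad X_A\perp\!\!\!\perp_{P(X_V|\mathrm{do}(X_J))}X_B\mid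 X_C ,$$ and also, making the dependence on $J$ explicit, $$A\perp^\sigma_{G}J\cup B\mid C\quad\Longrightarrow\quad X_A\perp\!\!\!\perp_{P(X_V|\mathrm{do}(X_J))}(X_J,X_B)\mid X_C .$$ (2) (Latent variables.) Let the output nodes of a causal Bayesian network with graph $G$ be split as $U\,\dot\cup\,V$ into latent nodes $U$ and observed nodes $V$. Let $G'$ be the marginal CDMG of $G$ on $(J,V)$, where $U$ is marginalized out, and let $P(X_V|\mathrm{do}(X_J))$ be the marginal on $\mathcal X_V$ of the joint kernel $P(X_U,X_V|\mathrm{do}(X_J))$. Then for all $A,B,C\subseteq J\cup V$, $$A\perp^\sigma_{G'}B\mid C\quad\Longrightarrow\quad X_A\perp\!\!\!\perp_{P(X_V|\mathrm{do}(X_J))}X_B\mid X_C .$$ -/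

import Mathlib

open MeasureTheory ProbabilityTheory

universe u v

/-! ### Conditional directed mixed graphs -/

/-- A conditional directed mixed graph on nodes taken from `α`: disjoint sets `J` (input nodes) and
`V` (output nodes), directed edges `E w v` (that is, `w → v`) with `w ∈ J ∪ V`, `v ∈ V`, and
bidirected edges `L v w` (that is, `v ↔ w`) between two different output nodes. -/
structure CDMG (α : Type u) where
  J : Set α
  V : Set α
  disjoint : Disjoint J V
  E : α → α → Prop
  L : α → α → Prop
  E_source : ∀ {w v}, E w v → w ∈ J ∪ V
  E_target : ∀ {w v}, E w v → v ∈ V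
  L_left : ∀ {v w}, L v w → v ∈ V
  L_right : ∀ {v w}, L v w → w ∈ V
  L_ne : ∀ {v w}, L v w → v ≠ w
  L_symm : ∀ {v w}, L v w → L w v

/-- The three ways to pass from a node `a` to the next node `b` of a walk:
`a → b`, `a ← b`, `a ↔ b`. -/
inductive EdgeKind where
  | right
  | left
  | bi

namespace EdgeKind

/-- The edge from `a` to `b` has an arrow head at `a`. -/
def HeadAtFirst : EdgeKind → Prop
  | right => False
  | left => True
  | bi => True

/-- The edge from `a` to `b` has an arrow head at `b`. -/
def HeadAtSecond : EdgeKind → Prop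
  | right => True
  | left => False
  | bi => True

end EdgeKind

namespace CDMG

variable {α : Type u}

/-- Parents. -/
def Pa (G : CDMG α) (v : α) : Set α := {w | G.E w v}

/-- Ancestors: `w` such that there is a (possibly trivial) directed walk from `w` to `v`. -/
def Anc (G : CDMG α) (v : α) : Set α := {w | Relation.ReflTransGen G.E w v}

/-- Descendants. -/
def Desc (G : CDMG α) (v : α) : Set α := {w | Relation.ReflTransGen G.E v w}

/-- Strongly connected component. -/
def Sc (G : CDMG α) (v : α) : Set α := G.Anc v ∩ G.Desc v

/-- Every directed walk from a node to itself is trivial. -/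
def Acyclic (G : CDMG α) : Prop := ∀ v, ¬ Relation.TransGen G.E v v

/-- `a` and `b` are joined in `G` by an edge of the given kind. -/
def Edge (G : CDMG α) : EdgeKind → α → α → Prop
  | .right, a, b => G.E a b
  | .left, a, b => G.E b a
  | .bi, a, b => G.L a b

/-- Walks, as alternating sequences of nodes and edges; repetitions are allowed, and so is the
trivial walk at a node. -/
inductive Walk (G : CDMG α) : α → α → Type u
  | nil (a : α) (ha : a ∈ G.J ∪ G.V) : Walk G a a
  | cons {a b c : α} (k : EdgeKind) (h : G.Edge k a b) (p : Walk G b c) : Walk G a c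

/-- Two adjacent edges `a — b — c` of a walk, of kinds `k` and `l`, are blocked by `C`:
left chain, right chain, fork, collider. -/
def BlockedTriple (G : CDMG α) (C : Set α) (a b c : α) (k l : EdgeKind) : Prop :=
  (k = .left ∧ l.HeadAtFirst ∧ b ∈ C ∧ b ∉ G.Sc a) ∨
  (k.HeadAtSecond ∧ l = .right ∧ b ∈ C ∧ b ∉ G.Sc c) ∨
  (k = .left ∧ l = .right ∧ b ∈ C ∧ b ∉ G.Sc a ∩ G.Sc c) ∨
  (k.HeadAtSecond ∧ l.HeadAtFirst ∧ b ∉ C)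

namespace Walk

variable {G : CDMG α}

/-- Two adjacent edges somewhere in the walk are blocked by `C`. -/
def HasBlockedTriple (C : Set α) : {a c : α} → G.Walk a c → Prop
  | _, _, nil _ _ => False
  | _, _, cons _ _ (nil _ _) => False
  | _, _, @cons _ _ a b _ k _ (@cons _ _ _ c _ l h p) =>
      G.BlockedTriple C a b c k l ∨ HasBlockedTriple C (cons l h p)

/-- `C`-`σ`-blocked walks. -/
def SigmaBlocked (C : Set α) {a c : α} (p : G.Walk a c) : Prop :=
  a ∈ C ∨ c ∈ C ∨ p.HasBlockedTriple C

end Walk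

/-- `A` is `σ`-separated from `B` given `C`: every walk from `A` to `J ∪ B` is `σ`-blocked by `C`.
Note the input nodes `J` in the second argument. -/
def SigmaSep (G : CDMG α) (A B C : Set α) : Prop :=
  ∀ a ∈ A, ∀ b ∈ G.J ∪ B, ∀ p : G.Walk a b, p.SigmaBlocked C

/-- There is a directed walk of length at least one from the first to the second node, all of whose
intermediate nodes lie in `W`. -/
inductive DirectedVia (G : CDMG α) (W : Set α) : α → α → Prop
  | edge {a b : α} : G.E a b → DirectedVia G W a b
  | step {a w b : α} : G.E a w → w ∈ W → DirectedVia G W w b → DirectedVia G W a b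

/-- There is a walk `a ← ⋯ ← x *→ y → ⋯ → b` with all intermediate nodes in `W` and with arrow heads
at both `a` and `b`: either the middle edge `x → y` is directed and `x ≠ a` is an intermediate node
with directed walks to `a` and to `b`; or the middle edge is `x ↔ y`, where `x` is `a` itself or an
intermediate node with a directed walk to `a`, and the same for `y` and `b`. -/
def TrekVia (G : CDMG α) (W : Set α) (a b : α) : Prop :=
  (∃ x ∈ W, G.DirectedVia W x a ∧ G.DirectedVia W x b) ∨
  (∃ x y, G.L x y ∧ (x = a ∨ (x ∈ W ∧ G.DirectedVia W x a)) ∧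
    (y = b ∨ (y ∈ W ∧ G.DirectedVia W y b)))

/-- The marginal CDMG (latent projection), where `W` is marginalized out of the output nodes. -/
def marginalize (G : CDMG α) (W : Set α) (_hW : W ⊆ G.V) : CDMG α where
  J := G.J
  V := G.V \ W
  disjoint := G.disjoint.mono_right Set.sdiff_subset
  E a b := a ∈ G.J ∪ (G.V \ W) ∧ b ∈ G.V \ W ∧ G.DirectedVia W a b
  L a b := a ∈ G.V \ W ∧ b ∈ G.V \ W ∧ a ≠ b ∧ G.TrekVia W a b
  E_source h := h.1
  E_target h := h.2.1
  L_left h := h.1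
  L_right h := h.2.1
  L_ne h := h.2.2.1
  L_symm := by
    rintro a b ⟨ha, hb, hne, h⟩
    refine ⟨hb, ha, hne.symm, ?_⟩
    rcases h with ⟨x, hx, h1, h2⟩ | ⟨x, y, hL, h1, h2⟩
    · exact Or.inl ⟨x, hx, h2, h1⟩
    · exact Or.inr ⟨y, x, G.L_symm hL, h2, h1⟩

/-- A topological order, presented as an enumeration `v₁ < v₂ < ⋯ < vₙ` of the set `S` of output
nodes in which every parent of an entry is an input node or an earlier entry. (Input nodes have no
parents and can always be put first.) -/
inductive TopOrder (G : CDMG α) : Set α → Type u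
  | nil : TopOrder G ∅
  | snoc {S : Set α} (o : TopOrder G S) (w : α) (hw : w ∈ G.V) (hwS : w ∉ S)
      (hpa : G.Pa w ⊆ G.J ∪ S) : TopOrder G (insert w S)

/-- A finite acyclic graph has a topological order. -/
theorem nonempty_topOrder (G : CDMG α) (hfin : G.V.Finite) (hac : G.Acyclic) :
    Nonempty (G.TopOrder G.V) := by
  have key : ∀ n : ℕ, ∀ S : Set α, S ⊆ G.V → (G.V \ S).ncard = n → G.TopOrder S →
      Nonempty (G.TopOrder G.V) := by
    intro n
    induction n with
    | zero =>
      intro S hS hn o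
      have h0 : G.V \ S = ∅ := (Set.ncard_eq_zero (hfin.subset Set.sdiff_subset)).1 hn
      have : S = G.V := hS.antisymm (Set.sdiff_eq_empty.1 h0)
      exact ⟨this ▸ o⟩
    | succ n ih =>
      intro S hS hn o
      have hne : (G.V \ S).Nonempty := by
        rw [← Set.ncard_pos (hfin.subset Set.sdiff_subset)]
        omega
      have hf : (G.V \ S).Finite := hfin.subset Set.sdiff_subset
      have : Finite (G.V \ S : Set α) := hf
      let r : (G.V \ S : Set α) → (G.V \ S : Set α) → Prop :=
        fun a b => Relation.TransGen G.E a.1 b.1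
      have : IsTrans _ r := ⟨fun _ _ _ h1 h2 => h1.trans h2⟩
      have : Std.Irrefl r := ⟨fun a h => hac a.1 h⟩
      have wf : WellFounded r := Finite.wellFounded_of_trans_of_irrefl r
      obtain ⟨m, -, hm⟩ := wf.has_min Set.univ ⟨⟨_, hne.some_mem⟩, trivial⟩
      have hpa : G.Pa m.1 ⊆ G.J ∪ S := by
        intro p hp
        rcases G.E_source hp with h | h
        · exact Or.inl h
        · by_contra hc
          exact hm ⟨p, h, fun hs => hc (Or.inr hs)⟩ trivial (Relation.TransGen.single hp)
      refine ih (insert m.1 S) (Set.insert_subset m.2.1 hS) ?_ (o.snoc m.1 m.2.1 m.2.2 hpa)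
      have h1 : G.V \ insert m.1 S = (G.V \ S) \ {m.1} := by
        ext x; simp only [Set.mem_sdiff, Set.mem_insert_iff, Set.mem_singleton_iff]; tauto
      rw [h1, Set.ncard_sdiff_singleton_of_mem m.2, hn]
      rfl
  exact key _ ∅ (Set.empty_subset _) rfl .nil

end CDMG

/-! ### Transitional conditional independence -/

section TransitionalCondIndep

variable {T W A B C : Type*} [MeasurableSpace T] [MeasurableSpace W] [MeasurableSpace A]
  [MeasurableSpace B] [MeasurableSpace C]

/-- The joint push-forward `K(X, Y, Z | T) = (X ⊗ Y ⊗ Z) ∘ K(W | T)` of three transitional random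
variables (Markov kernels on `W × T`) along a Markov kernel `K` from `T` to `W`. -/
noncomputable def jointPushforward (K : Kernel T W) (X : Kernel (W × T) A) (Y : Kernel (W × T) B)
    (Z : Kernel (W × T) C) : Kernel T (A × (B × C)) :=
  (X ×ₖ (Y ×ₖ Z)) ∘ₖ (K ×ₖ Kernel.id)

/-- `X` is transitionally independent of `Y` conditioned on `Z` with respect to `K`: there is a
Markov kernel `Q(X | Z)` with `K(X, Y, Z | T) = Q(X | Z) ⊗ K(Y, Z | T)`. The product on the right
sends `t` and `D` to `∫ ∫ 1_D (x, y, z) Q(dx | z) K(d(y, z) | t)`. -/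
def TransCondIndep (K : Kernel T W) [IsMarkovKernel K] (X : Kernel (W × T) A) [IsMarkovKernel X]
    (Y : Kernel (W × T) B) [IsMarkovKernel Y] (Z : Kernel (W × T) C) [IsMarkovKernel Z] : Prop :=
  ∃ Q : Kernel C A, IsMarkovKernel Q ∧
    jointPushforward K X Y Z =
      ((Q.comap (Prod.snd : B × C → C) measurable_snd) ×ₖ Kernel.id) ∘ₖ
        (jointPushforward K X Y Z).snd

end TransitionalCondIndep

/-! ### Causal Bayesian networks -/

section Coordinates

variable {α : Type u} (X : α → Type v)

/-- The product space `X_D = ∏_{v ∈ D} X_v`. -/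
abbrev PiOn (D : Set α) : Type (max u v) := ∀ d : D, X d

variable {X}

open Classical in
/-- The variable `X_D`, for `D ⊆ J ∪ S`, as a function of `(x_S, x_J)`. -/
noncomputable def coordMap {J S D : Set α} (hD : D ⊆ J ∪ S) (x : PiOn X S × PiOn X J) : PiOn X D :=
  fun d => if h : d.1 ∈ S then x.1 ⟨d.1, h⟩ else x.2 ⟨d.1, (hD d.2).resolve_right h⟩

open Classical in
/-- Append the value of one more coordinate. -/
noncomputable def insertCoord (S : Set α) (w : α) (x : PiOn X S × X w) : PiOn X (insert w S) :=
  fun d => if h : d.1 = w then cast (congrArg X h.symm) x.2 else x.1 ⟨d.1, d.2.resolve_left h⟩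

/-- Forget coordinates. -/
def restrictCoord {S D : Set α} (hD : D ⊆ S) (x : PiOn X S) : PiOn X D :=
  fun d => x ⟨d.1, hD d.2⟩

variable [∀ a, MeasurableSpace (X a)]

theorem measurable_coordMap {J S D : Set α} (hD : D ⊆ J ∪ S) :
    Measurable (coordMap (X := X) hD) := by
  refine measurable_pi_lambda _ fun d => ?_
  by_cases h : d.1 ∈ S
  · simp only [coordMap, h, dite_true]
    exact (measurable_pi_apply _).comp measurable_fst
  · simp only [coordMap, h, dite_false]
    exact (measurable_pi_apply _).comp measurable_snd

theorem measurable_insertCoord (S : Set α) (w : α) :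
    Measurable (insertCoord (X := X) S w) := by
  refine measurable_pi_lambda _ fun d => ?_
  obtain ⟨d, hd⟩ := d
  by_cases h : d = w
  · subst h
    simp only [insertCoord, dite_true]
    exact measurable_snd
  · simp only [insertCoord, h, dite_false]
    exact (measurable_pi_apply _).comp measurable_fst

theorem measurable_restrictCoord {S D : Set α} (hD : D ⊆ S) :
    Measurable (restrictCoord (X := X) hD) :=
  measurable_pi_lambda _ fun _ => measurable_pi_apply _

/-- The variable `X_D`, for `D ⊆ J ∪ S`, as a (deterministic) transitional random variable
on `X_S × X_J`. -/
noncomputable def coordVar {J S : Set α} (D : Set α) (hD : D ⊆ J ∪ S) :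
    Kernel (PiOn X S × PiOn X J) (PiOn X D) :=
  Kernel.deterministic (coordMap hD) (measurable_coordMap hD)

instance {J S : Set α} (D : Set α) (hD : D ⊆ J ∪ S) :
    IsMarkovKernel (coordVar (X := X) D hD) := by
  unfold coordVar; infer_instance

end Coordinates

/-- A causal Bayesian network with value spaces `X`: a finite conditional directed acyclic graph,
standard Borel spaces at the output nodes (arbitrary measurable spaces at the input nodes), and for
every output node `w` a Markov kernel from `X_{Pa(w)}` to `X_w`. -/
structure CausalBayesNet {α : Type u} (X : α → Type v) [∀ a, MeasurableSpace (X a)] where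
  G : CDMG α
  finite_J : G.J.Finite
  finite_V : G.V.Finite
  no_bidirected : ∀ a b, ¬ G.L a b
  acyclic : G.Acyclic
  standard : ∀ w ∈ G.V, StandardBorelSpace (X w)
  P : ∀ w ∈ G.V, Kernel (PiOn X (G.Pa w)) (X w)
  markov : ∀ w hw, IsMarkovKernel (P w hw)

/-- A causal Bayesian network with latent variables: some of the output nodes are declared
latent, the remaining ones are observed. -/
structure LatentCausalBayesNet {α : Type u} (X : α → Type v) [∀ a, MeasurableSpace (X a)] extends
    CausalBayesNet X where
  U : Set α
  U_subset : U ⊆ G.V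

namespace CausalBayesNet

variable {α : Type u} {X : α → Type v} [∀ a, MeasurableSpace (X a)]

/-- The product `P_{vₙ}(X_{vₙ} | do(X_{Pa(vₙ)})) ⊗ ⋯ ⊗ P_{v₁}(X_{v₁} | do(X_{Pa(v₁)}))`, a kernel
from `X_J` to `X_S`, along a topological order `v₁ < ⋯ < vₙ` of `S`. -/
noncomputable def kernelAlong (M : CausalBayesNet X) :
    {S : Set α} → M.G.TopOrder S → Kernel (PiOn X M.G.J) (PiOn X S)
  | _, .nil => Kernel.deterministic (fun _ d => d.2.elim) (measurable_pi_lambda _ fun d => d.2.elim)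
  | _, .snoc (S := S) o w hw _ hpa =>
      (M.kernelAlong o ⊗ₖ
        (M.P w hw).comap (fun x => coordMap hpa x.swap)
          ((measurable_coordMap hpa).comp measurable_swap)).map (insertCoord S w)

instance isMarkovKernel_kernelAlong (M : CausalBayesNet X) {S : Set α} (o : M.G.TopOrder S) :
    IsMarkovKernel (M.kernelAlong o) := by
  induction o with
  | nil => unfold kernelAlong; infer_instance
  | snoc o w hw hwS hpa ih =>
    have := M.markov w hw
    unfold kernelAlong
    exact Kernel.IsMarkovKernel.map _ (measurable_insertCoord _ _)

/-- The joint Markov kernel `P(X_V | do(X_J))`. -/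
noncomputable def jointKernel (M : CausalBayesNet X) (o : M.G.TopOrder M.G.V) :
    Kernel (PiOn X M.G.J) (PiOn X M.G.V) :=
  M.kernelAlong o

instance (M : CausalBayesNet X) (o : M.G.TopOrder M.G.V) : IsMarkovKernel (M.jointKernel o) :=
  M.isMarkovKernel_kernelAlong o

end CausalBayesNet

namespace LatentCausalBayesNet

variable {α : Type u} {X : α → Type v} [∀ a, MeasurableSpace (X a)]

/-- The marginal CADMG on the observed nodes. -/
def marginalGraph (M : LatentCausalBayesNet X) : CDMG α := M.G.marginalize M.U M.U_subset

/-- The observational Markov kernel: the marginal of the joint Markov kernel on the observed output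
variables. -/
noncomputable def observationalKernel (M : LatentCausalBayesNet X) (o : M.G.TopOrder M.G.V) :
    Kernel (PiOn X M.marginalGraph.J) (PiOn X M.marginalGraph.V) :=
  (M.jointKernel o).map (restrictCoord (Set.sdiff_subset : M.G.V \ M.U ⊆ M.G.V))

instance (M : LatentCausalBayesNet X) (o : M.G.TopOrder M.G.V) :
    IsMarkovKernel (M.observationalKernel o) :=
  Kernel.IsMarkovKernel.map (M.jointKernel o) (measurable_restrictCoord _)

end LatentCausalBayesNet

/-! The proof adds the output nodes one at a time along the topological order. For an initial
segment `S`, keep only the edges of the graph with target in `S`. The claim, for all `A`, `B`, `C`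
at once, is that d-separation of `A` from `J ∪ B` given `C` in this graph yields conditional
independence under the partial product over `S` (`condIndepAlong_of_dSep`).

The newest node `w` is a sink. If `w ∉ C`, it can be replaced by its parents on whichever side of
the separation it occurs, the induction hypothesis applies, and the kernel of `w` is multiplied back
in. If `w ∈ C`, the key is `DSep.diff_sink`: after `w` leaves `C`, it can join either the left side
or the right side while separation persists. This is the case `w ∉ C`, and weak union then moves `w`
back into the condition.

Having `J` on the right forces `A ∩ J ⊆ C`. This settles the base case, and it means that only
output coordinates, whose spaces are standard Borel, are ever disintegrated.

On the graph side only one implication is needed: a walk from `A` to `J ∪ B` with endpoints outside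
`C`, whose interior nodes lie in `C` exactly when they are colliders, is not `σ`-blocked, whatever
the strongly connected components are. With latent nodes, such a walk in the full graph is
contracted to an unblocked walk in the marginal graph. The full network then supplies the
independence, which passes to the marginal kernel. -/

/-! ### Separoid rules for conditional independence of functions under a kernel. -/

section FunctionalCI

variable {T W A B C : Type*} [MeasurableSpace T] [MeasurableSpace W] [MeasurableSpace A]
  [MeasurableSpace B] [MeasurableSpace C]

/-- Conditional independence of measurable functions `X`, `Y` given `Z` under a kernel `K`, tested
against nonnegative measurable functions, with a conditional distribution of `X` that is a function
of `Z` only. -/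
def HasCI (K : Kernel T W) (X : W × T → A) (Y : W × T → B) (Z : W × T → C) : Prop :=
  ∃ Q : Kernel C A, IsMarkovKernel Q ∧ ∀ t, ∀ f : A × B × C → ENNReal, Measurable f →
    ∫⁻ w, f (X (w, t), Y (w, t), Z (w, t)) ∂K t =
      ∫⁻ w, ∫⁻ x, f (x, Y (w, t), Z (w, t)) ∂Q (Z (w, t)) ∂K t

theorem measurable_lintegral_kernel_comp (Q : Kernel C A) [IsSFiniteKernel Q] {Z : W → C}
    (hZ : Measurable Z) {f : W × A → ENNReal} (hf : Measurable f) :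
    Measurable fun w => ∫⁻ x, f (w, x) ∂Q (Z w) :=
  hf.lintegral_kernel_prod_right' (κ := Q.comap Z hZ)

theorem lintegral_jointPushforward_deterministic (K : Kernel T W) [IsMarkovKernel K]
    {X : W × T → A} {Y : W × T → B} {Z : W × T → C} (hX : Measurable X) (hY : Measurable Y)
    (hZ : Measurable Z) (t : T) {f : A × B × C → ENNReal} (hf : Measurable f) :
    ∫⁻ p, f p ∂jointPushforward K (.deterministic X hX) (.deterministic Y hY)
        (.deterministic Z hZ) t =
      ∫⁻ w, f (X (w, t), Y (w, t), Z (w, t)) ∂K t := by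
  unfold jointPushforward
  rw [Kernel.deterministic_prod_deterministic, Kernel.deterministic_prod_deterministic,
    Kernel.lintegral_comp _ _ _ hf]
  simp only [Kernel.deterministic_apply, lintegral_dirac' _ hf]
  rw [Kernel.lintegral_prod _ _ _ (by fun_prop)]
  refine lintegral_congr fun w => ?_
  rw [Kernel.id_apply, lintegral_dirac' _ (by fun_prop)]

theorem HasCI.transCondIndep {K : Kernel T W} [IsMarkovKernel K]
    {X : W × T → A} {Y : W × T → B} {Z : W × T → C} (hX : Measurable X) (hY : Measurable Y)
    (hZ : Measurable Z) (h : HasCI K X Y Z) :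
    TransCondIndep K (.deterministic X hX) (.deterministic Y hY) (.deterministic Z hZ) := by
  obtain ⟨Q, hQ, h⟩ := h
  refine ⟨Q, hQ, ?_⟩
  refine Kernel.ext_fun fun t f hf => ?_
  rw [lintegral_jointPushforward_deterministic K hX hY hZ t hf, h t f hf,
    Kernel.lintegral_comp _ _ _ hf, Kernel.lintegral_snd _ _ (hf.lintegral_kernel)]
  have key (p : B × C) : ∫⁻ q, f q ∂((Q.comap (Prod.snd : B × C → C) measurable_snd ×ₖ
      (Kernel.id : Kernel (B × C) (B × C))) p) = ∫⁻ x, f (x, p) ∂Q p.2 := by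
    rw [Kernel.lintegral_prod _ _ _ hf, Kernel.comap_apply]
    refine lintegral_congr fun x => ?_
    rw [Kernel.id_apply, lintegral_dirac' _ (by fun_prop)]
  simp_rw [key]
  have hm : Measurable fun p : B × C => ∫⁻ x, f (x, p) ∂Q p.2 := by
    simp_rw [← key]; exact hf.lintegral_kernel
  rw [lintegral_jointPushforward_deterministic K hX hY hZ t (f := fun q => ∫⁻ x, f (x, q.2) ∂Q q.2.2)
    (hm.comp measurable_snd)]

/-- The new conditional distribution is the law of `g (x, z)` for `x` drawn from `Q z`. Dependence
of `Y'` on the input is harmless because the identity is tested at each fixed `t`. -/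
theorem HasCI.mono {A' B' : Type*} [MeasurableSpace A'] [MeasurableSpace B']
    {K : Kernel T W} {X : W × T → A} {Y : W × T → B} {Z : W × T → C}
    {X' : W × T → A'} {Y' : W × T → B'}
    {g : A × C → A'} (hg : Measurable g) (hX' : ∀ p, X' p = g (X p, Z p))
    {k : (B × C) × T → B'} (hk : Measurable k) (hY' : ∀ p, Y' p = k ((Y p, Z p), p.2))
    (h : HasCI K X Y Z) : HasCI K X' Y' Z := by
  obtain ⟨Q, hQ, h⟩ := h
  refine ⟨(Q ×ₖ Kernel.id).map g, Kernel.IsMarkovKernel.map _ hg, fun t f hf => ?_⟩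
  have h1 := h t (fun p => f (g (p.1, p.2.2), k ((p.2.1, p.2.2), t), p.2.2)) (by fun_prop)
  simp only [hX', hY']
  rw [h1]
  refine lintegral_congr fun w => ?_
  rw [Kernel.lintegral_map _ hg _ (by fun_prop), Kernel.lintegral_prod _ _ _ (by fun_prop)]
  refine lintegral_congr fun x => ?_
  rw [Kernel.id_apply, lintegral_dirac' _ (by fun_prop)]

/-- The extra information in `Z'` is a function of `(Y, Z)`, so the old `Q`, read through `g`, still
serves. -/
theorem HasCI.weakUnion_right {C' : Type*} [MeasurableSpace C']
    {K : Kernel T W} {X : W × T → A} {Y : W × T → B} {Z : W × T → C} {Z' : W × T → C'}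
    {g : C' → C} (hg : Measurable g) (hZ : ∀ p, Z p = g (Z' p))
    {k : B × C → C'} (hk : Measurable k) (hZ' : ∀ p, Z' p = k (Y p, Z p))
    (h : HasCI K X Y Z) : HasCI K X Y Z' := by
  obtain ⟨Q, hQ, h⟩ := h
  refine ⟨Q.comap g hg, inferInstance, fun t f hf => ?_⟩
  have h1 := h t (fun p => f (p.1, p.2.1, k (p.2.1, p.2.2))) (by fun_prop)
  simp only [← hZ'] at h1
  simp only [Kernel.comap_apply, ← hZ]
  exact h1

/-- Disintegrate `Q` into its `D`-marginal and a kernel `N` giving `X` from `(Z, X')`; `N` is the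
required conditional. Testing the hypothesis once with `f` and once with `f` already integrated
against `N` gives the same integral. This is where standard Borel spaces enter. -/
theorem HasCI.weakUnion_left {D : Type*} [MeasurableSpace D]
    [MeasurableSpace.CountablyGenerated D] [StandardBorelSpace A]
    {K : Kernel T W} {X : W × T → A} {Y : W × T → B} {Z : W × T → C} {X' : W × T → D}
    (h : HasCI K (fun p => (X' p, X p)) Y Z) :
    HasCI K X Y (fun p => (Z p, X' p)) := by
  obtain ⟨Q, hQ, h⟩ := h
  have : MeasurableSpace.CountableOrCountablyGenerated C D := ⟨Or.inr inferInstance⟩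
  obtain ⟨N, hN, hQN⟩ : ∃ N : Kernel (C × D) A, IsMarkovKernel N ∧ Q.fst ⊗ₖ N = Q := by
    -- Disintegration needs a point of `A`. If `A` is empty, a probability measure `Q c` on `D × A`
    -- cannot exist, so `C` is empty and any kernel out of it will do.
    by_cases hA : Nonempty A
    · exact ⟨Q.condKernel, inferInstance, Q.disintegrate _⟩
    · have hA' : IsEmpty A := not_nonempty_iff.1 hA
      have hC : IsEmpty C := by
        refine ⟨fun c => ?_⟩
        have h1 : Q c Set.univ = 1 := measure_univ
        rw [Set.univ_eq_empty_iff.2 inferInstance] at h1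
        simp at h1
      exact ⟨Kernel.ofFunOfCountable fun c => (IsEmpty.false c.1).elim, ⟨fun c => (IsEmpty.false c.1).elim⟩,
        Kernel.ext fun c => (IsEmpty.false c).elim⟩
  refine ⟨N, hN, fun t f hf => ?_⟩
  have h1 := h t (fun p => f (p.1.2, p.2.1, p.2.2, p.1.1)) (by fun_prop)
  have h2 := h t (fun p => ∫⁻ x, f (x, p.2.1, p.2.2, p.1.1) ∂N (p.2.2, p.1.1)) ?_
  · simp only at h1 h2
    rw [h1, h2]
    refine lintegral_congr fun w => ?_
    conv_lhs => rw [← hQN]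
    rw [Kernel.lintegral_compProd _ _ _ (by fun_prop), Kernel.lintegral_fst]
    exact measurable_lintegral_kernel_comp N (Z := fun d => (Z (w, t), d)) (by fun_prop)
      (f := fun q => f (q.2, Y (w, t), Z (w, t), q.1)) (by fun_prop)
  · exact measurable_lintegral_kernel_comp N (W := (D × A) × B × C)
      (Z := fun p => (p.2.2, p.1.1)) (by fun_prop)
      (f := fun q => f (q.2, q.1.2.1, q.1.2.2, q.1.1.1)) (by fun_prop)

theorem HasCI.map {W' : Type*} [MeasurableSpace W'] {K : Kernel T W} {r : W → W'}
    (hr : Measurable r) {X : W × T → A} {Y : W × T → B} {Z : W × T → C} {X' : W' × T → A}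
    {Y' : W' × T → B} {Z' : W' × T → C} (hX' : Measurable X') (hY' : Measurable Y')
    (hZ' : Measurable Z') (hX : ∀ w t, X' (r w, t) = X (w, t)) (hY : ∀ w t, Y' (r w, t) = Y (w, t))
    (hZ : ∀ w t, Z' (r w, t) = Z (w, t)) (h : HasCI K X Y Z) : HasCI (K.map r) X' Y' Z' := by
  obtain ⟨Q, hQ, h⟩ := h
  refine ⟨Q, hQ, fun t f hf => ?_⟩
  rw [Kernel.lintegral_map _ hr _ (by fun_prop), Kernel.lintegral_map _ hr _ ?_]
  · simp only [hX, hY, hZ]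
    exact h t f hf
  · exact measurable_lintegral_kernel_comp Q (Z := fun w => Z' (w, t)) (by fun_prop)
      (f := fun q => f (q.2, Y' (q.1, t), Z' (q.1, t))) (by fun_prop)

/-! ### Adjoining one variable drawn from a kernel of its parents. -/

section Extension

variable {E P : Type*} [MeasurableSpace E] [MeasurableSpace P]

theorem lintegral_compProd_map {W' : Type*} [MeasurableSpace W'] (K : Kernel T W) [IsSFiniteKernel K]
    (N : Kernel P E) [IsSFiniteKernel N] {pa : W × T → P} (hpa : Measurable pa) {ins : W × E → W'}
    (hins : Measurable ins) (t : T) {f : W' → ENNReal} (hf : Measurable f) :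
    ∫⁻ w, f w ∂(K ⊗ₖ N.comap (fun x : T × W => pa x.swap) (hpa.comp measurable_swap)).map ins t =
      ∫⁻ w, ∫⁻ e, f (ins (w, e)) ∂N (pa (w, t)) ∂K t := by
  rw [Kernel.lintegral_map _ hins _ hf, Kernel.lintegral_compProd _ _ _ (by fun_prop)]
  rfl

variable {W' : Type*} [MeasurableSpace W'] {K : Kernel T W}
    {N : Kernel P E} [IsMarkovKernel N] {K'   : Kernel T W'} {pa : W × T → P}
    {ins : W × E → W'}
    {X : W × T → A} {Y : W × T → B} {Z : W × T → C}
    {A' B' : Type*} [MeasurableSpace A'] [MeasurableSpace B']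

theorem HasCI.extend {X' : W' × T → A} {Y' : W' × T → B} {Z' : W' × T → C}
    (hK' : ∀ t (f : W' → ENNReal), Measurable f →
      ∫⁻ w, f w ∂K' t = ∫⁻ w, ∫⁻ e, f (ins (w, e)) ∂N (pa (w, t)) ∂K t)
    (hX' : Measurable X') (hY' : Measurable Y') (hZ' : Measurable Z')
    (hX : ∀ w e t, X' (ins (w, e), t) = X (w, t))
    (hY : ∀ w e t, Y' (ins (w, e), t) = Y (w, t))
    (hZ : ∀ w e t, Z' (ins (w, e), t) = Z (w, t))
    (h : HasCI K X Y Z) : HasCI K' X' Y' Z' := by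
  obtain ⟨Q, hQ, h⟩ := h
  refine ⟨Q, hQ, fun t f hf => ?_⟩
  rw [hK' t _ (by fun_prop), hK' t (fun w => ∫⁻ x, f (x, Y' (w, t), Z' (w, t)) ∂Q (Z' (w, t))) ?_]
  · simp only [hX, hY, hZ, lintegral_const, measure_univ, mul_one]
    exact h t f hf
  · exact measurable_lintegral_kernel_comp _ (Z := fun w => Z' (w, t)) (by fun_prop)
        (f := fun q => f (q.2, Y' (q.1, t), Z' (q.1, t))) (by fun_prop)

/-- Since the parents are read off `X`, the new conditional draws `x` from `Q`, then `e` from `N (g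
x)`. -/
theorem HasCI.extend_left {X' : W' × T → A'} {Y' : W' × T → B} {Z' : W' × T → C}
    (hK' : ∀ t (f : W' → ENNReal), Measurable f →
      ∫⁻ w, f w ∂K' t = ∫⁻ w, ∫⁻ e, f (ins (w, e)) ∂N (pa (w, t)) ∂K t)
    (hX' : Measurable X') (hY' : Measurable Y') (hZ' : Measurable Z')
    {g : A → P} (hg : Measurable g) (hpa : ∀ p, pa p = g (X p))
    {j : A × E → A'} (hj : Measurable j)
    (hX : ∀ w e t, X' (ins (w, e), t) = j (X (w, t), e))
    (hY : ∀ w e t, Y' (ins (w, e), t) = Y (w, t))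
    (hZ : ∀ w e t, Z' (ins (w, e), t) = Z (w, t))
    (h : HasCI K X Y Z) : HasCI K' X' Y' Z' := by
  obtain ⟨Q, hQ, h⟩ := h
  refine ⟨(Q ⊗ₖ N.comap (fun p : C × A => g p.2) (by fun_prop)).map j,
    Kernel.IsMarkovKernel.map _ hj, fun t f hf => ?_⟩
  rw [hK' t _ (by fun_prop), hK' t (fun w => ∫⁻ x, f (x, Y' (w, t), Z' (w, t)) ∂_) ?_]
  · simp only [hX, hY, hZ, lintegral_const, measure_univ, mul_one, hpa]
    have h1 := h t (fun p => ∫⁻ e, f (j (p.1, e), p.2) ∂N (g p.1)) ?_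
    · simp only at h1
      rw [h1]
      refine lintegral_congr fun w => ?_
      rw [Kernel.lintegral_map _ hj _ (by fun_prop), Kernel.lintegral_compProd _ _ _ (by fun_prop)]
      rfl
    · exact measurable_lintegral_kernel_comp N (Z := fun p : A × B × C => g p.1) (by fun_prop)
        (f := fun q => f (j (q.1.1, q.2), q.1.2)) (by fun_prop)
  · exact measurable_lintegral_kernel_comp _ (Z := fun w => Z' (w, t)) (by fun_prop)
        (f := fun q => f (q.2, Y' (q.1, t), Z' (q.1, t))) (by fun_prop)

/-- The same `Q` works: given `w`, the draws of `x` and of `e` do not influence each other, so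
Tonelli exchanges them. -/
theorem HasCI.extend_right {X' : W' × T → A} {Y' : W' × T → B'} {Z' : W' × T → C}
    (hK' : ∀ t (f : W' → ENNReal), Measurable f →
      ∫⁻ w, f w ∂K' t = ∫⁻ w, ∫⁻ e, f (ins (w, e)) ∂N (pa (w, t)) ∂K t)
    (hX' : Measurable X') (hY' : Measurable Y') (hZ' : Measurable Z')
    {g : B → P} (hg : Measurable g) (hpa : ∀ p, pa p = g (Y p))
    {j : B × E → B'} (hj : Measurable j)
    (hX : ∀ w e t, X' (ins (w, e), t) = X (w, t))
    (hY : ∀ w e t, Y' (ins (w, e), t) = j (Y (w, t), e))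
    (hZ : ∀ w e t, Z' (ins (w, e), t) = Z (w, t))
    (h : HasCI K X Y Z) : HasCI K' X' Y' Z' := by
  obtain ⟨Q, hQ, h⟩ := h
  refine ⟨Q, hQ, fun t f hf => ?_⟩
  rw [hK' t _ (by fun_prop), hK' t (fun w => ∫⁻ x, f (x, Y' (w, t), Z' (w, t)) ∂Q (Z' (w, t))) ?_]
  · simp only [hX, hY, hZ, hpa]
    have h1 := h t (fun p => ∫⁻ e, f (p.1, j (p.2.1, e), p.2.2) ∂N (g p.2.1)) ?_
    · simp only at h1
      rw [h1]
      refine lintegral_congr fun w => ?_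
      rw [lintegral_lintegral_swap]
      · exact Measurable.aemeasurable (by fun_prop)
    · exact measurable_lintegral_kernel_comp N (Z := fun p : A × B × C => g p.2.1) (by fun_prop)
        (f := fun q => f (q.1.1, j (q.1.2.1, q.2), q.1.2.2)) (by fun_prop)
  · exact measurable_lintegral_kernel_comp _ (Z := fun w => Z' (w, t)) (by fun_prop)
        (f := fun q => f (q.2, Y' (q.1, t), Z' (q.1, t))) (by fun_prop)

end Extension

end FunctionalCI

/-! ### Open walks in directed graphs and d-separation. -/

namespace CDMG

variable {α : Type u}

/-- `OpenTo E C b d a`: in the directed graph with edges `E` there is a walk from `a` to `b` with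
`b ∉ C` whose interior nodes lie in `C` exactly when they are colliders; `d` tells whether its
first edge has an arrow head at `a`. -/
inductive OpenTo (E : α → α → Prop) (C : Set α) (b : α) : Bool → α → Prop
  | refl (hb : b ∉ C) : OpenTo E C b false b
  | out {d a c} (p : OpenTo E C b d c) (h : E a c) (hc : c ∈ C ↔ d = true) : OpenTo E C b false a
  | into {d a c} (p : OpenTo E C b d c) (h : E c a) (hc : c ∉ C) : OpenTo E C b true a

/-- No open walk leads from `A` to `B`. -/
def DSep (E : α → α → Prop) (A B C : Set α) : Prop :=
  ∀ a ∈ A, a ∉ C → ∀ b ∈ B, ∀ d, ¬ OpenTo E C b d a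

theorem OpenTo.mono {E E' : α → α → Prop} (hE : ∀ x y, E x y → E' x y) {C : Set α} {a b : α}
    {d : Bool} (p : OpenTo E C b d a) : OpenTo E' C b d a := by
  induction p with
  | refl hb => exact .refl hb
  | out _ h hc ih => exact .out ih (hE _ _ h) hc
  | into _ h hc ih => exact .into ih (hE _ _ h) hc

theorem OpenTo.notMem_target {E : α → α → Prop} {C : Set α} {a b : α}
    {d : Bool} (p : OpenTo E C b d a) : b ∉ C := by
  induction p with
  | refl hb => exact hb
  | out _ _ _ ih => exact ih
  | into _ _ _ ih => exact ih

theorem DSep.mono {E E' : α → α → Prop} (hE : ∀ x y, E x y → E' x y) {A A' B B' C : Set α}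
    (hA : A ⊆ A') (hB : B ⊆ B') (h : DSep E' A' B' C) : DSep E A B C :=
  fun a ha haC b hb d p => h a (hA ha) haC b (hB hb) d (p.mono hE)

theorem DSep.subset_of_mem_target {E : α → α → Prop} {A B C : Set α} (h : DSep E A B C) :
    A ∩ B ⊆ C := by
  intro a ha
  by_contra haC
  exact h a ha.1 haC a ha.2 _ (.refl haC)

/-- Extend an open walk by an edge into a node outside `C` at its end. -/
theorem OpenTo.append {E : α → α → Prop} {C : Set α} {a c w : α} {d : Bool}
    (p : OpenTo E C c d a) (h : E c w) (hw : w ∉ C) : OpenTo E C w d a := by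
  induction p with
  | refl hb => exact .out (.refl hw) h (by simp [hw])
  | out _ hE hc ih => exact .out ih hE hc
  | into _ hE hc ih => exact .into ih hE hc

/-- An open walk from a parent `x ∉ C` extends by `w ← x`: there `x` is a non-collider, so the
longer walk from `w` is open. -/
theorem DSep.parents_left {E : α → α → Prop} {A B C : Set α} {w : α} (hw : w ∈ A) (hwC : w ∉ C)
    (h : DSep E A B C) : DSep E (A ∪ {x | E x w}) B C := by
  rintro a (ha | ha) haC b hb d p
  · exact h a ha haC b hb d p
  · exact h w hw hwC b hb true (.into p ha haC)

theorem DSep.parents_right {E : α → α → Prop} {A B C : Set α} {w : α} (hw : w ∈ B) (hwC : w ∉ C)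
    (h : DSep E A B C) : DSep E A (B ∪ {x | E x w}) C := by
  rintro a ha haC b (hb | hb) d p
  · exact h a ha haC b hb d p
  · exact h a ha haC w hw d (p.append hb hwC)

/-- A sink is an interior node of an open walk only if it is a collider. -/
theorem OpenTo.of_diff_sink {E : α → α → Prop} {w : α} (hw : ∀ c, ¬ E w c) {C : Set α} {a b : α}
    {d : Bool} (hb : b ≠ w) (p : OpenTo E (C \ {w}) b d a) :
    OpenTo E C b d a ∧ (a = w → d = true) := by
  induction p with
  | refl hbC => exact ⟨.refl fun h => hbC ⟨h, hb⟩, fun h => absurd h hb⟩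
  | @out d a c _ hE hc ih =>
    have hcw : c ≠ w := fun h => (hc.2 (ih.2 h)).2 h
    refine ⟨.out ih.1 hE ?_, ?_⟩
    · rw [← hc]; simp [hcw]
    · rintro rfl; exact absurd hE (hw _)
  | @into d a c _ hE hc ih =>
    have hcw : c ≠ w := by rintro rfl; exact hw _ hE
    exact ⟨.into ih.1 hE fun h => hc ⟨h, hcw⟩, fun _ => rfl⟩

/-- Two open walks meeting in a sink can be joined when the sink is conditioned on. -/
theorem OpenTo.trans_sink {E : α → α → Prop} {w : α} (hw : ∀ c, ¬ E w c) {C : Set α} (hwC : w ∈ C)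
    {a b : α} {d : Bool} (q : OpenTo E C b true w) (p : OpenTo E (C \ {w}) w d a) :
    a = w ∧ d = false ∨ OpenTo E C b d a := by
  induction p with
  | refl => exact Or.inl ⟨rfl, rfl⟩
  | @out d a c _ hE hc ih =>
    refine Or.inr ?_
    rcases ih with ⟨rfl, rfl⟩ | ih
    -- Where `p` reaches `w`, the rest is replaced by `q`; arrow heads meet at `w`, an admissible
    -- collider because `w ∈ C`.
    · exact .out q hE (by simp [hwC])
    · by_cases hcw : c = w
      · subst hcw
        exact .out q hE (by simp [hwC])
      · exact .out ih hE (by rw [← hc]; simp [hcw])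
  | @into d a c _ hE hc ih =>
    have hcw : c ≠ w := by rintro rfl; exact hw _ hE
    rcases ih with ⟨rfl, -⟩ | ih
    · exact absurd rfl hcw
    · exact Or.inr (.into ih hE fun h => hc ⟨h, hcw⟩)

/-- If both alternatives failed, there would be two walks open given `C \ {w}`. A walk ending away
from `w` does not pass through `w`, since a sink is interior only as a collider and colliders must
lie in `C \ {w}`. So either one of the two walks is already open from `A` to `B` given `C`, or one
starts at `w` and the other ends there, and gluing them at the collider `w ∈ C` gives such a walk.
-/
theorem DSep.diff_sink {E : α → α → Prop} {w : α} (hw : ∀ c, ¬ E w c) {A B C : Set α} (hwC : w ∈ C)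
    (h : DSep E A B C) :
    DSep E (insert w A) (B \ {w}) (C \ {w}) ∨ DSep E (A \ {w}) (insert w B) (C \ {w}) := by
  by_contra hc
  simp only [DSep, not_or, not_forall, not_not] at hc
  obtain ⟨⟨a, ha, haC, b, hb, d, p⟩, a', ha', haC', b', hb', d', p'⟩ := hc
  have hp := p.of_diff_sink hw hb.2
  by_cases haw : a = w
  · subst haw
    obtain rfl := hp.2 rfl
    have haC'' : a' ∉ C := fun h => haC' ⟨h, ha'.2⟩
    by_cases hbw : b' = a
    · subst hbw
      rcases hp.1.trans_sink hw hwC p' with h' | h'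
      · exact ha'.2 h'.1
      · exact h a' ha'.1 haC'' b hb.1 _ h'
    · exact h a' ha'.1 haC'' b' (hb'.resolve_left hbw) _ (p'.of_diff_sink hw hbw).1
  · exact h a (ha.resolve_left haw) (fun h => haC ⟨h, haw⟩) b hb.1 _ hp.1

/-! ### Unblocked walks -/

namespace Walk

variable {G : CDMG α}

/-- For a nontrivial walk, `d` tells whether its first edge has an arrow head at the first node. For
a trivial walk, `d` is `false` and the node is outside `C`. -/
def Starts (C : Set α) (d : Bool) : {a b : α} → G.Walk a b → Prop
  | _, _, nil a _ => a ∉ C ∧ d = false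
  | _, _, cons k _ _ => k.HeadAtFirst ↔ d = true

end Walk

/-- There is a walk from `a` to `b` without blocked triples that starts as described by `d`. -/
def Unblocked (G : CDMG α) (C : Set α) (b : α) (d : Bool) (a : α) : Prop :=
  ∃ p : G.Walk a b, ¬ p.HasBlockedTriple C ∧ p.Starts C d

/-- Every non-collider pattern of blocking requires `c ∈ C`, and the collider pattern requires `c ∉
C`. The condition `hc` excludes all of them without consulting `Sc`. -/
theorem Unblocked.cons {G : CDMG α} {C : Set α} {a b c : α} {d d' : Bool}
    (h : G.Unblocked C b d c) (k : EdgeKind) (hk : G.Edge k a c)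
    (hc : c ∈ C ↔ (d = true ∧ k.HeadAtSecond)) (hd' : k.HeadAtFirst ↔ d' = true) :
    G.Unblocked C b d' a := by
  obtain ⟨p, hp, hs⟩ := h
  refine ⟨.cons k hk p, ?_, hd'⟩
  cases p with
  | nil _ _ => simp [Walk.HasBlockedTriple]
  | @cons _ e _ l hl q =>
    rw [Walk.HasBlockedTriple, not_or]
    refine ⟨?_, hp⟩
    simp only [Walk.Starts] at hs
    rw [← hs] at hc
    rintro (⟨rfl, h1, h2, -⟩ | ⟨h1, rfl, h2, -⟩ | ⟨rfl, rfl, h2, -⟩ | ⟨h1, h2, h3⟩)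
    · exact (hc.1 h2).2
    · exact (hc.1 h2).1
    · exact (hc.1 h2).2
    · exact h3 (hc.2 ⟨h2, h1⟩)

theorem SigmaSep.not_unblocked {G : CDMG α} {A B C : Set α} (h : G.SigmaSep A B C) {a b : α}
    (ha : a ∈ A) (haC : a ∉ C) (hb : b ∈ G.J ∪ B) (hbC : b ∉ C) {d : Bool} :
    ¬ G.Unblocked C b d a := by
  rintro ⟨p, hp, -⟩
  rcases h a ha b hb p with h | h | h
  · exact haC h
  · exact hbC h
  · exact hp h

theorem OpenTo.unblocked {G : CDMG α} {C : Set α} {a b : α} {d : Bool} (hb : b ∈ G.J ∪ G.V)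
    (p : OpenTo G.E C b d a) : G.Unblocked C b d a := by
  induction p with
  | refl hbC => exact ⟨.nil b hb, by simp [Walk.HasBlockedTriple], hbC, rfl⟩
  | out _ hE hc ih =>
    exact ih.cons .right hE (by simpa [EdgeKind.HeadAtSecond] using hc)
      (by simp [EdgeKind.HeadAtFirst])
  | into _ hE hc ih =>
    exact ih.cons .left hE (by simpa [EdgeKind.HeadAtSecond] using hc)
      (by simp [EdgeKind.HeadAtFirst])

theorem SigmaSep.dSep {G : CDMG α} {A B C : Set α} (hB : B ⊆ G.J ∪ G.V) (h : G.SigmaSep A B C) :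
    DSep G.E A (G.J ∪ B) C :=
  fun _ ha haC _ hb _ p => h.not_unblocked ha haC hb p.notMem_target
    (p.unblocked (Set.union_subset Set.subset_union_left hB hb))

/-! ### Walks in the latent projection -/

theorem DirectedVia.append {G : CDMG α} {W : Set α} {a b c : α} (h : G.DirectedVia W a b)
    (hb : b ∈ W) (hE : G.E b c) : G.DirectedVia W a c := by
  induction h with
  | edge h => exact .step h hb (.edge hE)
  | step h hw _ ih => exact .step h hw (ih hb hE)

section Marginalize

variable {G : CDMG α} {U : Set α} (hU : U ⊆ G.V) (C : Set α) (b : α)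

/-- What an open walk of `G` that starts at `a` says about the marginal graph. -/
def MarginalOpen (d : Bool) (a : α) : Prop :=
  (a ∉ U ∧ ((G.marginalize U hU).Unblocked C b d a ∨
    a ∉ C ∧ (G.marginalize U hU).Unblocked C b false a)) ∨
  (a ∈ U ∧ d = false ∧ ∃ c d', c ∉ U ∧ (G.marginalize U hU).Unblocked C b d' c ∧
    (c ∈ C ↔ d' = true) ∧ G.DirectedVia U a c) ∨
  (a ∈ U ∧ d = true ∧ ∃ c d', c ∉ U ∧ (G.marginalize U hU).Unblocked C b d' c ∧
    c ∉ C ∧ G.DirectedVia U c a) ∨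
  (a ∈ U ∧ d = true ∧ ∃ c d', c ∉ U ∧ (G.marginalize U hU).Unblocked C b d' c ∧
    (c ∈ C ↔ d' = true) ∧ ∃ x ∈ U, G.DirectedVia U x a ∧ G.DirectedVia U x c)

theorem DirectedVia.source {G : CDMG α} {W : Set α} {a b : α} (h : G.DirectedVia W a b) :
    a ∈ G.J ∪ G.V := by
  cases h with
  | edge h => exact G.E_source h
  | step h _ _ => exact G.E_source h

theorem DirectedVia.target {G : CDMG α} {W : Set α} {a b : α} (h : G.DirectedVia W a b) :
    b ∈ G.V := by
  induction h with
  | edge h => exact G.E_target h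
  | step _ _ _ ih => exact ih

variable {C b}

theorem Unblocked.marginalize_out {a c : α} {d : Bool}
    (h : (G.marginalize U hU).Unblocked C b d c) (ha : a ∉ U) (hc : c ∉ U)
    (hcC : c ∈ C ↔ d = true) (hac : G.DirectedVia U a c) :
    (G.marginalize U hU).Unblocked C b false a := by
  have h1 : (G.marginalize U hU).E a c :=
    ⟨hac.source.imp_right fun h => ⟨h, ha⟩, ⟨hac.target, hc⟩, hac⟩
  exact h.cons .right h1 (by simpa [EdgeKind.HeadAtSecond] using hcC)
    (by simp [EdgeKind.HeadAtFirst])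

theorem Unblocked.marginalize_into {a c : α} {d : Bool}
    (h : (G.marginalize U hU).Unblocked C b d c) (ha : a ∉ U) (hc : c ∉ U)
    (hcC : c ∉ C) (hca : G.DirectedVia U c a) :
    (G.marginalize U hU).Unblocked C b true a := by
  have h1 : (G.marginalize U hU).E c a :=
    ⟨hca.source.imp_right fun h => ⟨h, hc⟩, ⟨hca.target, ha⟩, hca⟩
  exact h.cons .left h1 (by simpa [EdgeKind.HeadAtSecond] using hcC)
    (by simp [EdgeKind.HeadAtFirst])

/-- A fork through latent nodes becomes a bidirected edge, except when it returns to the same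
observed node. That detour is dropped; the remaining walk may then start with a tail, which is
harmless since in that case `a ∉ C`. -/
theorem Unblocked.marginalize_fork {a c x : α} {d : Bool}
    (h : (G.marginalize U hU).Unblocked C b d c) (ha : a ∉ U) (hc : c ∉ U)
    (hcC : c ∈ C ↔ d = true) (hx : x ∈ U) (hxa : G.DirectedVia U x a) (hxc : G.DirectedVia U x c) :
    (G.marginalize U hU).Unblocked C b true a ∨
      a ∉ C ∧ (G.marginalize U hU).Unblocked C b false a := by
  by_cases hac : a = c
  · subst hac
    cases d with
    | true => exact Or.inl h
    | false => exact Or.inr ⟨by simpa using hcC, h⟩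
  · have h1 : (G.marginalize U hU).L a c :=
      ⟨⟨hxa.target, ha⟩, ⟨hxc.target, hc⟩, hac, Or.inl ⟨x, hx, hxa, hxc⟩⟩
    exact Or.inl (h.cons .bi h1 (by simpa [EdgeKind.HeadAtSecond] using hcC)
      (by simp [EdgeKind.HeadAtFirst]))

/-- Latent nodes are outside `C`, so a stretch through them has no collider: it is directed one way,
directed the other way, or a fork. While the current node is latent, the invariant records this
shape and the observed node `c` where the stretch ends. Reaching an observed node turns the stretch
into a single marginal edge or deletes it. -/
theorem OpenTo.marginalOpen {a : α} {d : Bool} (hb : b ∈ G.J ∪ G.V) (hbU : b ∉ U)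
    (hCU : ∀ x ∈ C, x ∉ U) (p : OpenTo G.E C b d a) : MarginalOpen hU C b d a := by
  induction p with
  | refl hbC =>
    exact Or.inl ⟨hbU, Or.inl ⟨.nil b (hb.imp_right fun h => ⟨h, hbU⟩),
      by simp [Walk.HasBlockedTriple], hbC, rfl⟩⟩
  | @out d a c _ hE hc ih =>
    rcases ih with ⟨hcU, ih⟩ | ⟨hcU, rfl, e, d', heU, ih, he, hv⟩ | ⟨hcU, rfl, -⟩ | ⟨hcU, rfl, -⟩
    · obtain ⟨d', ih, hd'⟩ : ∃ d', (G.marginalize U hU).Unblocked C b d' c ∧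
          (c ∈ C ↔ d' = true) := by
        rcases ih with ih | ⟨h1, ih⟩
        · exact ⟨d, ih, hc⟩
        · exact ⟨false, ih, by simp [h1]⟩
      by_cases ha : a ∈ U
      · exact Or.inr (Or.inl ⟨ha, rfl, c, d', hcU, ih, hd', .edge hE⟩)
      · exact Or.inl ⟨ha, Or.inl (ih.marginalize_out hU ha hcU hd' (.edge hE))⟩
    · by_cases ha : a ∈ U
      · exact Or.inr (Or.inl ⟨ha, rfl, e, d', heU, ih, he, .step hE hcU hv⟩)
      · exact Or.inl ⟨ha, Or.inl (ih.marginalize_out hU ha heU he (.step hE hcU hv))⟩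
    -- Here the latent `c` would be a collider, hence in `C`.
    · exact absurd hcU (hCU c (hc.2 rfl))
    · exact absurd hcU (hCU c (hc.2 rfl))
  | @into d a c _ hE hc ih =>
    rcases ih with ⟨hcU, ih⟩ | ⟨hcU, rfl, e, d', heU, ih, he, hv⟩ |
      ⟨hcU, rfl, e, d', heU, ih, he, hv⟩ | ⟨hcU, rfl, e, d', heU, ih, he, x, hx, hxc, hxe⟩
    · obtain ⟨d', ih⟩ : ∃ d', (G.marginalize U hU).Unblocked C b d' c := by
        rcases ih with ih | ⟨h1, ih⟩
        · exact ⟨d, ih⟩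
        · exact ⟨false, ih⟩
      by_cases ha : a ∈ U
      · exact Or.inr (Or.inr (Or.inl ⟨ha, rfl, c, d', hcU, ih, hc, .edge hE⟩))
      · exact Or.inl ⟨ha, Or.inl (ih.marginalize_into hU ha hcU hc (.edge hE))⟩
    · by_cases ha : a ∈ U
      · exact Or.inr (Or.inr (Or.inr ⟨ha, rfl, e, d', heU, ih, he, c, hcU, .edge hE, hv⟩))
      · exact Or.inl ⟨ha, ih.marginalize_fork hU ha heU he hcU (.edge hE) hv⟩
    · by_cases ha : a ∈ U
      · exact Or.inr (Or.inr (Or.inl ⟨ha, rfl, e, d', heU, ih, he, hv.append hcU hE⟩))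
      · exact Or.inl ⟨ha, Or.inl (ih.marginalize_into hU ha heU he (hv.append hcU hE))⟩
    · by_cases ha : a ∈ U
      · exact Or.inr (Or.inr (Or.inr ⟨ha, rfl, e, d', heU, ih, he, x, hx, hxc.append hcU hE, hxe⟩))
      · exact Or.inl ⟨ha, ih.marginalize_fork hU ha heU he hx (hxc.append hcU hE) hxe⟩

/-- Separation in the latent projection implies separation in the original graph. -/
theorem SigmaSep.dSep_of_marginalize {A B : Set α} (hA : A ⊆ G.J ∪ (G.V \ U))
    (hB : B ⊆ G.J ∪ (G.V \ U)) (hC : C ⊆ G.J ∪ (G.V \ U))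
    (h : (G.marginalize U hU).SigmaSep A B C) : DSep G.E A (G.J ∪ B) C := by
  have key : ∀ x ∈ G.J ∪ (G.V \ U), x ∉ U := fun x hx hxU =>
    hx.elim (fun hJ => Set.disjoint_left.1 G.disjoint hJ (hU hxU)) fun hV => hV.2 hxU
  intro a ha haC b hb d p
  have hb' : b ∈ G.J ∪ (G.V \ U) := Set.union_subset Set.subset_union_left hB hb
  have haU := key a (hA ha)
  rcases p.marginalOpen hU (hb'.imp_right fun h => h.1) (key b hb') (fun x hx => key x (hC hx)) with
    ⟨-, h' | ⟨-, h'⟩⟩ | ⟨h', -⟩ | ⟨h', -⟩ | ⟨h', -⟩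
  · exact h.not_unblocked ha haC hb p.notMem_target h'
  · exact h.not_unblocked ha haC hb p.notMem_target h'
  · exact haU h'
  · exact haU h'
  · exact haU h'

end Marginalize

end CDMG

/-! ### Compatibility of coordinate projections. -/

section CoordinateIdentities

variable {α : Type u} {X : α → Type v} {J S : Set α}

theorem coordMap_coordMap {D D₁ D₂ : Set α} (h₁ : D₁ ⊆ J ∪ S) (h₂ : D₂ ⊆ J ∪ S)
    (h : D ⊆ D₂ ∪ D₁) (hD : D ⊆ J ∪ S) (p : PiOn X S × PiOn X J) :
    coordMap h (coordMap h₁ p, coordMap h₂ p) = coordMap hD p := by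
  funext d
  by_cases hd : d.1 ∈ D₁ <;> simp [coordMap, hd]

theorem coordMap_restrictCoord {S' D : Set α} (hS : S' ⊆ S) (hD : D ⊆ J ∪ S') (hD' : D ⊆ J ∪ S)
    (hJ : Disjoint J S) (x : PiOn X S) (t : PiOn X J) :
    coordMap hD (restrictCoord hS x, t) = coordMap hD' (x, t) := by
  funext d
  by_cases hd : d.1 ∈ S'
  · simp [coordMap, restrictCoord, hd, hS hd]
  · have hdS : d.1 ∉ S := fun h => Set.disjoint_left.1 hJ ((hD d.2).resolve_right hd) h
    simp [coordMap, hd, hdS]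

theorem coordMap_insertCoord_of_notMem {w : α} {D : Set α} (hwD : w ∉ D) (hD : D ⊆ J ∪ S)
    (hD' : D ⊆ J ∪ insert w S) (x : PiOn X S) (e : X w) (t : PiOn X J) :
    coordMap hD' (insertCoord S w (x, e), t) = coordMap hD (x, t) := by
  funext d
  have hdw : d.1 ≠ w := fun h => hwD (h ▸ d.2)
  by_cases hd : d.1 ∈ S <;> simp [coordMap, insertCoord, hd, hdw]

theorem coordMap_insertCoord_insert {w : α} {D : Set α} (hD : D ⊆ J ∪ S)
    (hD' : insert w D ⊆ J ∪ insert w S) (x : PiOn X S) (e : X w) (t : PiOn X J) :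
    coordMap hD' (insertCoord S w (x, e), t) = insertCoord D w (coordMap hD (x, t), e) := by
  funext d
  by_cases hdw : d.1 = w
  · simp [coordMap, insertCoord, hdw]
  · by_cases hd : d.1 ∈ S <;> simp [coordMap, insertCoord, hd, hdw]

end CoordinateIdentities

theorem CDMG.TopOrder.subset {α : Type u} {G : CDMG α} {S : Set α} (o : G.TopOrder S) :
    S ⊆ G.V := by
  induction o with
  | nil => exact Set.empty_subset _
  | snoc o w hw _ _ ih => exact Set.insert_subset hw ih

theorem CDMG.TopOrder.pa_subset {α : Type u} {G : CDMG α} {S : Set α} (o : G.TopOrder S) :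
    ∀ c ∈ S, G.Pa c ⊆ G.J ∪ S := by
  induction o with
  | nil => exact fun c hc => hc.elim
  | @snoc S o w hw _ hpa ih =>
    have hS : G.J ∪ S ⊆ G.J ∪ insert w S := Set.union_subset_union_right _ (Set.subset_insert _ _)
    rintro c (rfl | hc)
    · exact hpa.trans hS
    · exact (ih c hc).trans hS

/-- The newest node of a topological order is a sink of the graph spanned so far. -/
theorem CDMG.TopOrder.sink {α : Type u} {G : CDMG α} {S : Set α} (o : G.TopOrder S) {w : α}
    (hw : w ∈ G.V) (hwS : w ∉ S) (hpa : G.Pa w ⊆ G.J ∪ S) (c : α) :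
    ¬ (G.E w c ∧ c ∈ insert w S) := by
  have hwJS : w ∉ G.J ∪ S := fun h =>
    h.elim (fun h => Set.disjoint_left.1 G.disjoint h hw) hwS
  rintro ⟨hE, rfl | hc⟩
  · exact hwJS (hpa hE)
  · exact hwJS (o.pa_subset c hc hE)

/-! ### The Markov property of partial products, by induction on the order. -/

namespace CausalBayesNet

variable {α : Type u} {X : α → Type v} [∀ a, MeasurableSpace (X a)] (M : CausalBayesNet X)

/-- Conditional independence of `X_A` and `X_B` given `X_C` under the partial product of the
network along `o`. -/
def CondIndepAlong {S : Set α} (o : M.G.TopOrder S) {A B C : Set α} (hA : A ⊆ M.G.J ∪ S)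
    (hB : B ⊆ M.G.J ∪ S) (hC : C ⊆ M.G.J ∪ S) : Prop :=
  HasCI (M.kernelAlong o) (coordMap (X := X) hA) (coordMap (X := X) hB) (coordMap (X := X) hC)

variable {M}

theorem CondIndepAlong.mono {S : Set α} {o : M.G.TopOrder S} {A B C A' B' : Set α}
    {hA : A ⊆ M.G.J ∪ S} {hB : B ⊆ M.G.J ∪ S} {hC : C ⊆ M.G.J ∪ S}
    (h : M.CondIndepAlong o hA hB hC) (hA' : A' ⊆ C ∪ A) (hB' : B' ⊆ C ∪ B)
    (hA'S : A' ⊆ M.G.J ∪ S) (hB'S : B' ⊆ M.G.J ∪ S) : M.CondIndepAlong o hA'S hB'S hC :=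
  HasCI.mono (measurable_coordMap hA') (fun p => (coordMap_coordMap hA hC hA' _ p).symm)
    ((measurable_coordMap hB').comp measurable_fst)
    (fun p => (coordMap_coordMap hB hC hB' _ p).symm) h

theorem CondIndepAlong.weakUnion_right {S : Set α} {o : M.G.TopOrder S} {A B C C' : Set α}
    {hA : A ⊆ M.G.J ∪ S} {hB : B ⊆ M.G.J ∪ S} {hC : C ⊆ M.G.J ∪ S}
    (h : M.CondIndepAlong o hA hB hC) (hCC' : C ⊆ C') (hC' : C' ⊆ C ∪ B)
    (hC'S : C' ⊆ M.G.J ∪ S) : M.CondIndepAlong o hA hB hC'S :=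
  HasCI.weakUnion_right (measurable_restrictCoord hCC') (fun _ => rfl)
    (measurable_coordMap hC') (fun p => (coordMap_coordMap hB hC hC' _ p).symm) h

/-- Input spaces need not be standard Borel, so only `A \ C` is disintegrated; by `hAC` it consists
of output nodes. The rest of `A` is restored from the condition. -/
theorem CondIndepAlong.weakUnion_left {S : Set α} {o : M.G.TopOrder S} {A B C C' D : Set α}
    {hA : A ⊆ M.G.J ∪ S} {hB : B ⊆ M.G.J ∪ S} {hC : C ⊆ M.G.J ∪ S}
    (h : M.CondIndepAlong o hA hB hC) (hAC : A ∩ M.G.J ⊆ C) (hDA : D ⊆ A) (hDS : D ⊆ S)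
    (hCC' : C ⊆ C') (hDC' : D ⊆ C') (hC' : C' ⊆ C ∪ D) (hC'S : C' ⊆ M.G.J ∪ S) :
    M.CondIndepAlong o hA hB hC'S := by
  have hstd (F : Set α) (hF : F ⊆ S) : StandardBorelSpace (PiOn X F) := by
    have : Countable F := ((M.finite_V.subset (hF.trans o.subset))).countable
    have (d : F) : StandardBorelSpace (X d) := M.standard _ (o.subset (hF d.2))
    infer_instance
  have := hstd D hDS
  have hAA : A \ C ⊆ A := Set.sdiff_subset
  have hA' : A \ C ⊆ S := fun a ha => (hA ha.1).resolve_left fun hJ => ha.2 (hAC ⟨ha.1, hJ⟩)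
  have := hstd (A \ C) hA'
  have hD := hDA.trans hA
  have h1 : HasCI (M.kernelAlong o)
      (fun p => (coordMap (X := X) hD p, coordMap (X := X) (hAA.trans hA) p))
      (coordMap (X := X) hB) (coordMap (X := X) hC) :=
    HasCI.mono (g := fun q => (restrictCoord hDA q.1, restrictCoord hAA q.1))
      (((measurable_restrictCoord _).prodMk (measurable_restrictCoord _)).comp measurable_fst)
      (fun p => rfl) (k := fun q => q.1.1) (by fun_prop) (fun p => rfl) h
  have h2 := h1.weakUnion_left
  have h3 : M.CondIndepAlong o (hAA.trans hA) hB hC'S :=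
    h2.weakUnion_right (g := fun z => (restrictCoord hCC' z, restrictCoord hDC' z))
      ((measurable_restrictCoord _).prodMk (measurable_restrictCoord _)) (fun _ => rfl)
      (k := fun q => coordMap hC' q.2.swap)
      ((measurable_coordMap hC').comp (measurable_swap.comp measurable_snd))
      (fun p => (coordMap_coordMap hD hC hC' _ p).symm)
  refine h3.mono (fun a ha => ?_) Set.subset_union_right hA hB
  by_cases haC : a ∈ C
  · exact Or.inl (hCC' haC)
  · exact Or.inr ⟨ha, haC⟩

section Snoc

variable {S : Set α} {o : M.G.TopOrder S} {w : α} {hw : w ∈ M.G.V} {hwS : w ∉ S}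
  {hpa : M.G.Pa w ⊆ M.G.J ∪ S} {A B C : Set α} {hA : A ⊆ M.G.J ∪ S} {hB : B ⊆ M.G.J ∪ S}
  {hC : C ⊆ M.G.J ∪ S}

theorem lintegral_kernelAlong_snoc (t : PiOn X M.G.J) (f : PiOn X (insert w S) → ENNReal)
    (hf : Measurable f) :
    ∫⁻ x, f x ∂M.kernelAlong (o.snoc w hw hwS hpa) t =
      ∫⁻ x, ∫⁻ e, f (insertCoord S w (x, e)) ∂M.P w hw (coordMap hpa (x, t)) ∂M.kernelAlong o t := by
  have := M.markov w hw
  exact lintegral_compProd_map (M.kernelAlong o) (M.P w hw) (measurable_coordMap hpa)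
    (measurable_insertCoord S w) t hf

theorem CondIndepAlong.snoc (h : M.CondIndepAlong o hA hB hC) (hwA : w ∉ A) (hwB : w ∉ B)
    (hwC : w ∉ C) (hA' : A ⊆ M.G.J ∪ insert w S) (hB' : B ⊆ M.G.J ∪ insert w S)
    (hC' : C ⊆ M.G.J ∪ insert w S) :
    M.CondIndepAlong (o.snoc w hw hwS hpa) hA' hB' hC' := by
  have := M.markov w hw
  exact HasCI.extend lintegral_kernelAlong_snoc (measurable_coordMap hA') (measurable_coordMap hB')
    (measurable_coordMap hC') (coordMap_insertCoord_of_notMem hwA hA hA')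
    (coordMap_insertCoord_of_notMem hwB hB hB') (coordMap_insertCoord_of_notMem hwC hC hC') h

theorem CondIndepAlong.snoc_left (h : M.CondIndepAlong o hA hB hC) (hPA : M.G.Pa w ⊆ A)
    (hwB : w ∉ B) (hwC : w ∉ C) (hA' : insert w A ⊆ M.G.J ∪ insert w S)
    (hB' : B ⊆ M.G.J ∪ insert w S) (hC' : C ⊆ M.G.J ∪ insert w S) :
    M.CondIndepAlong (o.snoc w hw hwS hpa) hA' hB' hC' := by
  have := M.markov w hw
  exact HasCI.extend_left lintegral_kernelAlong_snoc (measurable_coordMap hA')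
    (measurable_coordMap hB') (measurable_coordMap hC') (measurable_restrictCoord hPA)
    (fun _ => rfl) (measurable_insertCoord A w) (coordMap_insertCoord_insert hA hA')
    (coordMap_insertCoord_of_notMem hwB hB hB') (coordMap_insertCoord_of_notMem hwC hC hC') h

theorem CondIndepAlong.snoc_right (h : M.CondIndepAlong o hA hB hC) (hPB : M.G.Pa w ⊆ B)
    (hwA : w ∉ A) (hwC : w ∉ C) (hA' : A ⊆ M.G.J ∪ insert w S)
    (hB' : insert w B ⊆ M.G.J ∪ insert w S) (hC' : C ⊆ M.G.J ∪ insert w S) :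
    M.CondIndepAlong (o.snoc w hw hwS hpa) hA' hB' hC' := by
  have := M.markov w hw
  exact HasCI.extend_right lintegral_kernelAlong_snoc (measurable_coordMap hA')
    (measurable_coordMap hB') (measurable_coordMap hC') (measurable_restrictCoord hPB)
    (fun _ => rfl) (measurable_insertCoord B w) (coordMap_insertCoord_of_notMem hwA hA hA')
    (coordMap_insertCoord_insert hB hB') (coordMap_insertCoord_of_notMem hwC hC hC') h

end Snoc

theorem condIndepAlong_of_subset {S : Set α} (o : M.G.TopOrder S) {A B C : Set α}
    (hA : A ⊆ M.G.J ∪ S) (hB : B ⊆ M.G.J ∪ S) (hC : C ⊆ M.G.J ∪ S) (hAC : A ⊆ C) :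
    M.CondIndepAlong o hA hB hC := by
  refine ⟨Kernel.deterministic (restrictCoord hAC) (measurable_restrictCoord hAC), inferInstance,
    fun t f hf => ?_⟩
  refine lintegral_congr fun x => ?_
  rw [Kernel.deterministic_apply, lintegral_dirac' _ (by fun_prop)]
  rfl

/-- The global Markov property for the partial products along a topological order. -/
theorem condIndepAlong_of_dSep {S : Set α} (o : M.G.TopOrder S) : ∀ {A B C : Set α}
    (hA : A ⊆ M.G.J ∪ S) (hB : B ⊆ M.G.J ∪ S) (hC : C ⊆ M.G.J ∪ S),
    CDMG.DSep (fun x y => M.G.E x y ∧ y ∈ S) A (M.G.J ∪ B) C → M.CondIndepAlong o hA hB hC := by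
  induction o with
  | nil =>
    intro A B C hA hB hC h
    -- With no outputs yet, `A ⊆ J`, and trivial walks from `A` to `J` force `A ⊆ C`.
    refine condIndepAlong_of_subset _ hA hB hC fun a ha => h.subset_of_mem_target ⟨ha, ?_⟩
    exact Or.inl ((hA ha).resolve_right fun h => h.elim)
  | @snoc S o w hw hwS hpa ih =>
    have hwJ : w ∉ M.G.J := fun h => Set.disjoint_left.1 M.G.disjoint h hw
    have hE : ∀ x y, M.G.E x y ∧ y ∈ S → M.G.E x y ∧ y ∈ insert w S :=
      fun x y h => ⟨h.1, Or.inr h.2⟩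
    have hPa : M.G.Pa w ⊆ {x | M.G.E x w ∧ w ∈ insert w S} := fun x hx => ⟨hx, Or.inl rfl⟩
    have hins {D : Set α} (hD : D ⊆ M.G.J ∪ S) : insert w D ⊆ M.G.J ∪ insert w S :=
      Set.insert_subset (Or.inr (Or.inl rfl))
        (hD.trans (Set.union_subset_union_right _ (Set.subset_insert _ _)))
    have drop {D : Set α} (hD : D ⊆ M.G.J ∪ insert w S) : D \ {w} ⊆ M.G.J ∪ S :=
      fun _ hd => (hD hd.1).imp_right fun h => h.resolve_left hd.2
    have hcover (D P : Set α) : D ⊆ insert w (D \ {w} ∪ P) := fun d hd => by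
      by_cases h : d = w
      · exact Or.inl h
      · exact Or.inr (Or.inl ⟨hd, h⟩)
    have step : ∀ {A B C : Set α} (hA : A ⊆ M.G.J ∪ insert w S) (hB : B ⊆ M.G.J ∪ insert w S)
        (hC : C ⊆ M.G.J ∪ insert w S), w ∉ C →
        CDMG.DSep (fun x y => M.G.E x y ∧ y ∈ insert w S) A (M.G.J ∪ B) C →
        M.CondIndepAlong (o.snoc w hw hwS hpa) hA hB hC := by
      intro A B C hA hB hC hwC h
      have lower {D : Set α} (hD : D ⊆ M.G.J ∪ insert w S) (hwD : w ∉ D) : D ⊆ M.G.J ∪ S :=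
        (Set.sdiff_singleton_eq_self hwD) ▸ drop hD
      by_cases hwA : w ∈ A
      · have hwB : w ∉ B := fun hwB => hwC (h.subset_of_mem_target ⟨hwA, Or.inr hwB⟩)
        have h1 := ih (Set.union_subset (drop hA) hpa) (lower hB hwB)
          (lower hC hwC) ((h.parents_left hwA hwC).mono hE
            (Set.union_subset_union Set.sdiff_subset hPa) subset_rfl)
        exact (h1.snoc_left (hw := hw) (hwS := hwS) (hpa := hpa) Set.subset_union_right hwB hwC
          (hins (Set.union_subset (drop hA) hpa)) hB hC).mono
          ((hcover A _).trans Set.subset_union_right) Set.subset_union_right hA hB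
      · by_cases hwB : w ∈ B
        · have h1 := ih (lower hA hwA) (Set.union_subset (drop hB) hpa)
            (lower hC hwC) ((h.parents_right (B := M.G.J ∪ B) (Or.inr hwB) hwC).mono hE subset_rfl (by
              rw [← Set.union_assoc]
              exact Set.union_subset_union (Set.union_subset_union_right _ Set.sdiff_subset) hPa))
          exact (h1.snoc_right (hw := hw) (hwS := hwS) (hpa := hpa) Set.subset_union_right hwA hwC
            hA (hins (Set.union_subset (drop hB) hpa)) hC).mono
            Set.subset_union_right ((hcover B _).trans Set.subset_union_right) hA hB
        · exact (ih (lower hA hwA) (lower hB hwB) (lower hC hwC)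
            (h.mono hE subset_rfl subset_rfl)).snoc hwA hwB hwC hA hB hC
    intro A B C hA hB hC h
    by_cases hwC : w ∈ C
    · have hwC' : w ∉ C \ {w} := fun h => h.2 rfl
      have hC' : C \ {w} ⊆ M.G.J ∪ insert w S := Set.sdiff_subset.trans hC
      have hadd {D : Set α} (hD : D ⊆ M.G.J ∪ insert w S) : insert w D ⊆ M.G.J ∪ insert w S :=
        Set.insert_subset (Or.inr (Or.inl rfl)) hD
      have hAC : A ∩ M.G.J ⊆ C := fun a ha => h.subset_of_mem_target ⟨ha.1, Or.inl ha.2⟩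
      -- In each case `w` is uncovered from `C`, so `step` applies; left or right weak union then
      -- conditions on `w` again.
      rcases h.diff_sink (o.sink hw hwS hpa) hwC with h | h
      · have hB' : M.G.J ∪ B \ {w} ⊆ (M.G.J ∪ B) \ {w} := by
          rintro x (hJ | hx)
          · exact ⟨Or.inl hJ, fun hxw => hwJ (hxw ▸ hJ)⟩
          · exact ⟨Or.inr hx.1, hx.2⟩
        have h1 := step (hadd hA) (Set.sdiff_subset.trans hB : B \ {w} ⊆ _) hC' hwC'
          (h.mono (fun _ _ => id) subset_rfl hB')
        have h2 := h1.weakUnion_left (D := {w}) (by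
            rintro a ⟨rfl | ha, haJ⟩
            · exact absurd haJ hwJ
            · exact ⟨hAC ⟨ha, haJ⟩, fun haw => hwJ (haw ▸ haJ)⟩)
          (Set.singleton_subset_iff.2 (Or.inl rfl)) (Set.singleton_subset_iff.2 (Or.inl rfl))
          Set.sdiff_subset (Set.singleton_subset_iff.2 hwC) (by simp) hC
        exact h2.mono ((Set.subset_insert w A).trans Set.subset_union_right)
          (fun x hx => by
            by_cases hxw : x = w
            · exact Or.inl (hxw ▸ hwC)
            · exact Or.inr ⟨hx, hxw⟩) hA hB
      · have hB' : M.G.J ∪ insert w B ⊆ insert w (M.G.J ∪ B) := by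
          rw [Set.union_insert]
        have h1 := step (Set.sdiff_subset.trans hA : A \ {w} ⊆ _) (hadd hB) hC' hwC'
          (h.mono (fun _ _ => id) subset_rfl hB')
        have h2 := h1.weakUnion_right (C' := C) Set.sdiff_subset (fun x hx => by
          by_cases hxw : x = w
          · exact Or.inr (Or.inl hxw)
          · exact Or.inl ⟨hx, hxw⟩) hC
        exact h2.mono (fun x hx => by
          by_cases hxw : x = w
          · exact Or.inl (hxw ▸ hwC)
          · exact Or.inr ⟨hx, hxw⟩) ((Set.subset_insert w B).trans Set.subset_union_right) hA hB
    · exact step hA hB hC hwC h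

theorem condIndepAlong_of_dSep_graph (o : M.G.TopOrder M.G.V) {A B C : Set α}
    (hA : A ⊆ M.G.J ∪ M.G.V) (hB : B ⊆ M.G.J ∪ M.G.V) (hC : C ⊆ M.G.J ∪ M.G.V)
    (h : CDMG.DSep M.G.E A (M.G.J ∪ B) C) : M.CondIndepAlong o hA hB hC :=
  condIndepAlong_of_dSep o hA hB hC (h.mono (fun _ _ h => h.1) subset_rfl subset_rfl)

end CausalBayesNet

theorem mainTheorem4 {α : Type u} {X : α → Type v} [∀ a, MeasurableSpace (X a)] :
    -- networks without latent variables
    (∀ (M : CausalBayesNet X) (o : M.G.TopOrder M.G.V) (A B C : Set α)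
      (hA : A ⊆ M.G.J ∪ M.G.V) (hB : B ⊆ M.G.J ∪ M.G.V) (hC : C ⊆ M.G.J ∪ M.G.V),
      (M.G.SigmaSep A B C →
        TransCondIndep (M.jointKernel o) (coordVar A hA) (coordVar B hB) (coordVar C hC)) ∧
      (M.G.SigmaSep A (M.G.J ∪ B) C →
        TransCondIndep (M.jointKernel o) (coordVar A hA)
          (coordVar M.G.J Set.subset_union_left ×ₖ coordVar B hB) (coordVar C hC))) ∧
    -- networks with latent variables
    (∀ (M : LatentCausalBayesNet X) (o : M.G.TopOrder M.G.V) (A B C : Set α)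
      (hA : A ⊆ M.marginalGraph.J ∪ M.marginalGraph.V)
      (hB : B ⊆ M.marginalGraph.J ∪ M.marginalGraph.V)
      (hC : C ⊆ M.marginalGraph.J ∪ M.marginalGraph.V),
      M.marginalGraph.SigmaSep A B C →
        TransCondIndep (M.observationalKernel o) (coordVar A hA) (coordVar B hB)
          (coordVar C hC)) := by
  refine ⟨fun M o A B C hA hB hC => ⟨fun h => ?_, fun h => ?_⟩, fun M o A B C hA hB hC h => ?_⟩
  · exact (CausalBayesNet.condIndepAlong_of_dSep_graph o hA hB hC (h.dSep hB)).transCondIndep _ _ _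
  · have hJB : M.G.J ∪ B ⊆ M.G.J ∪ M.G.V := Set.union_subset Set.subset_union_left hB
    have h1 := CausalBayesNet.condIndepAlong_of_dSep_graph o hA hJB hC (h.dSep hJB)
    have h2 : HasCI (M.jointKernel o) (coordMap (X := X) hA)
        (fun p => (coordMap (X := X) (Set.subset_union_left : M.G.J ⊆ M.G.J ∪ M.G.V) p,
          coordMap (X := X) hB p)) (coordMap (X := X) hC) :=
      HasCI.mono (g := Prod.fst) measurable_fst (fun _ => rfl)
        (k := fun q => (restrictCoord Set.subset_union_left q.1.1,
          restrictCoord Set.subset_union_right q.1.1))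
        (((measurable_restrictCoord _).prodMk (measurable_restrictCoord _)).comp
          (measurable_fst.comp measurable_fst)) (fun _ => rfl) h1
    have h3 := h2.transCondIndep (measurable_coordMap _)
      ((measurable_coordMap _).prodMk (measurable_coordMap _)) (measurable_coordMap _)
    simpa only [coordVar, Kernel.deterministic_prod_deterministic] using h3
  · have hV : M.G.J ∪ (M.G.V \ M.U) ⊆ M.G.J ∪ M.G.V :=
      Set.union_subset_union_right _ Set.sdiff_subset
    have h1 := CausalBayesNet.condIndepAlong_of_dSep_graph o (hA.trans hV) (hB.trans hV)
      (hC.trans hV) (CDMG.SigmaSep.dSep_of_marginalize M.U_subset hA hB hC h)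
    have h2 : HasCI (M.observationalKernel o) (coordMap (X := X) hA) (coordMap (X := X) hB)
        (coordMap (X := X) hC) :=
      HasCI.map (measurable_restrictCoord _) (measurable_coordMap hA) (measurable_coordMap hB)
        (measurable_coordMap hC) (coordMap_restrictCoord _ hA (hA.trans hV) M.G.disjoint)
        (coordMap_restrictCoord _ hB (hB.trans hV) M.G.disjoint)
        (coordMap_restrictCoord _ hC (hC.trans hV) M.G.disjoint) h1
    exact h2.transCondIndep _ _ _
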